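/- Let $(\Omega,\mathfrak F,\mathbb P)$ be a probability space, let $H\in(0,\tfrac12)$, and let $B^H=\{B^H_t,\ t\ge 0\}$ be a fractional Brownian motion with Hurst index $H$ on it, that is, a centered Gaussian process with covariance function $$\mathbb E\,B^H_sB^H_t=\tfrac12\left(s^{2H}+t^{2H}-|t-s|^{2H}\right),\qquad s,t\ge0,$$ and almost surely continuous paths. Let $x_0,\theta\in\mathbb R$ and let the process $X=\{X_t,\ t\ge0\}$ satisfy the Langevin equation $$X_t=x_0+\theta\int_0^tX_s\,ds+B^H_t,\qquad t\ge0,$$ almost surely, meaning that almost surely $s\mapsto X_s$ is Lebesgue integrable on $[0,t]$ and the equation holds for all $t\ge0$. Then, with probability $1$, $$\int_0^TX_s^2\,ds\to\infty\qquad\text{as }T\to\infty.$$ -/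

import Mathlib

open MeasureTheory ProbabilityTheory Filter
open scoped NNReal

/-- `B` is a fractional Brownian motion with Hurst index `H` under `P`: a centered Gaussian process
indexed by `t ≥ 0` with covariance `(s ^ (2H) + t ^ (2H) - |t - s| ^ (2H)) / 2` and
almost surely continuous paths. -/
structure IsFractionalBrownianMotion {Ω : Type*} [MeasurableSpace Ω] (H : ℝ)
    (B : ℝ≥0 → Ω → ℝ) (P : Measure Ω) : Prop where
  isGaussianProcess : IsGaussianProcess B P
  integral_eq_zero : ∀ t, ∫ ω, B t ω ∂P = 0
  covariance_eq : ∀ s t : ℝ≥0, covariance (B s) (B t) P =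
    ((s : ℝ) ^ (2 * H) + (t : ℝ) ^ (2 * H) - |(t : ℝ) - (s : ℝ)| ^ (2 * H)) / 2
  continuous_paths : ∀ᵐ ω ∂P, Continuous fun t => B t ω

/-- `X` solves the Langevin equation `X_t = x₀ + θ ∫_0^t X_s ds + B_t`, `t ≥ 0`, driven by `B`:
almost surely, the path of `X` is Lebesgue integrable on every `[0, t]` and the equation holds
for all `t ≥ 0` simultaneously. Paths are indexed by `ℝ≥0`; under the integral sign the variable
`s ∈ (0, t]` is a real number and is turned into an index by `Real.toNNReal`. -/
structure IsLangevinSolution {Ω : Type*} [MeasurableSpace Ω] (x₀ θ : ℝ)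
    (B X : ℝ≥0 → Ω → ℝ) (P : Measure Ω) : Prop where
  integrable_paths : ∀ᵐ ω ∂P, ∀ t : ℝ≥0,
    IntervalIntegrable (fun s : ℝ => X s.toNNReal ω) volume 0 t
  equation : ∀ᵐ ω ∂P, ∀ t : ℝ≥0,
    X t ω = x₀ + θ * (∫ s in (0 : ℝ)..t, X s.toNNReal ω) + B t ω

/-!
Finite energy would make the noise die out. If `∫_0^∞ X² < ∞` on some path, then
by the equation `B_{t+1} - B_t = X_{t+1} - X_t - θ ∫_t^{t+1} X`, and Cauchy–Schwarz gives
`∫_n^{n+1} (B_{t+1} - B_t)² dt → 0` (`tendsto_integral_sq_increment`). In particular the functions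
`t ↦ B_{n+t+1} - B_{n+t}` on `(0, 1]` tend to `0` in Lebesgue measure
(`one_le_liminf_volume_abs_le`).

Every variable `B_{n+t+1} - B_{n+t}` is standard normal
(`IsFractionalBrownianMotion.map_increment`), and variables with a fixed nondegenerate law cannot
do this: by Fatou and Fubini, the probability that `|B_{n+t+1} - B_{n+t}| ≤ ε` on asymptotically
all of `(0, 1]` is at most the standard normal measure of `[-ε, ε]`
(`measure_one_le_liminf_volume_le`), which vanishes as `ε → 0`. Only the common law of the
increments enters, so no ergodicity is required. Fubini needs a jointly measurable version of `B`,
which path continuity provides (`exists_measurable_continuous_version`).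
-/

/-! ### Paths of finite energy -/

/-- A locally integrable solution of the Langevin equation with continuous noise is continuous. -/
lemma continuous_of_langevin_equation {x₀ θ : ℝ} {b x : ℝ≥0 → ℝ} (hb : Continuous b)
    (hint : ∀ t : ℝ≥0, IntervalIntegrable (fun s : ℝ => x s.toNNReal) volume 0 t)
    (heq : ∀ t : ℝ≥0, x t = x₀ + θ * (∫ s in (0 : ℝ)..t, x s.toNNReal) + b t) :
    Continuous x := by
  have hcont : Continuous fun t : ℝ≥0 => ∫ s in (0 : ℝ)..t, x s.toNNReal := by
    rw [continuous_iff_continuousAt]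
    intro t
    have ht : (t : ℝ) < ((t + 1 : ℝ≥0) : ℝ) := by simp
    have h1 := intervalIntegral.continuousOn_primitive_interval' (hint (t + 1))
      Set.left_mem_uIcc t (by rw [Set.uIcc_of_le (t + 1).coe_nonneg]; exact ⟨t.coe_nonneg, ht.le⟩)
    refine h1.tendsto.comp (tendsto_nhdsWithin_iff.2 ⟨NNReal.continuous_coe.tendsto t, ?_⟩)
    filter_upwards [(NNReal.continuous_coe.tendsto t).eventually (gt_mem_nhds ht)] with s hs
    rw [Set.uIcc_of_le (t + 1).coe_nonneg]
    exact ⟨s.coe_nonneg, hs.le⟩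
  have : x = fun t : ℝ≥0 => x₀ + θ * (∫ s in (0 : ℝ)..t, x s.toNNReal) + b t := funext heq
  rw [this]
  fun_prop

/-- If `∫_0^∞ f² < ∞`, the unit-step increments of `t ↦ f t - θ ∫_0^t f` tend to `0` in `L²` over
the intervals `(n, n + 1]`. -/
lemma tendsto_integral_sq_increment {f : ℝ → ℝ} (hf : Continuous f) (θ : ℝ)
    (h : ¬ Tendsto (fun T : ℝ => ∫ s in (0 : ℝ)..T, f s ^ 2) atTop atTop) :
    Tendsto (fun n : ℕ => ∫ t in (0 : ℝ)..1,
      (f (n + t + 1) - f (n + t) - θ * ∫ s in (n + t)..(n + t + 1), f s) ^ 2) atTop (nhds 0) := by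
  set F : ℝ → ℝ := fun T => ∫ s in (0 : ℝ)..T, f s ^ 2 with hF
  have hint : ∀ a b : ℝ, IntervalIntegrable (fun s => f s ^ 2) volume a b := fun a b =>
    (hf.pow 2).intervalIntegrable a b
  have hsub : ∀ a b, F b - F a = ∫ s in a..b, f s ^ 2 := fun a b =>
    intervalIntegral.integral_interval_sub_left (hint _ _) (hint _ _)
  have hmono : Monotone F := fun a b hab => by
    have : 0 ≤ ∫ s in a..b, f s ^ 2 :=
      intervalIntegral.integral_nonneg hab fun _ _ => sq_nonneg _
    linarith [hsub a b]
  obtain ⟨l, hl⟩ := (tendsto_atTop_of_monotone hmono).resolve_left h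
  have hcast : Tendsto (fun n : ℕ => (n : ℝ)) atTop atTop := tendsto_natCast_atTop_atTop
  have hr : Tendsto (fun n : ℕ => 3 * (2 + θ ^ 2) * (F (n + 2) - F n)) atTop (nhds 0) := by
    have h2 := (hl.comp (tendsto_atTop_add_const_right atTop 2 hcast)).sub (hl.comp hcast)
    simpa using h2.const_mul (3 * (2 + θ ^ 2))
  refine squeeze_zero (fun n => intervalIntegral.integral_nonneg zero_le_one
    fun _ _ => sq_nonneg _) (fun n => ?_) hr
  set r := F (n + 2) - F n
  have hprim : ∀ a : ℝ, Continuous fun t : ℝ => ∫ s in a..t, f s := fun a =>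
    intervalIntegral.continuous_primitive (fun a b => hf.intervalIntegrable a b) a
  have hwin : Continuous fun t : ℝ => ∫ s in ((n : ℝ) + t)..(n + t + 1), f s := by
    have : (fun t : ℝ => ∫ s in ((n : ℝ) + t)..(n + t + 1), f s) =
        fun t : ℝ => (∫ s in (0 : ℝ)..(n + t + 1), f s) - ∫ s in (0 : ℝ)..(n + t), f s := by
      funext t
      exact (intervalIntegral.integral_interval_sub_left (hf.intervalIntegrable _ _)
        (hf.intervalIntegrable _ _)).symm
    rw [this]
    exact ((hprim 0).comp (by fun_prop)).sub ((hprim 0).comp (by fun_prop))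
  -- Cauchy–Schwarz on an interval of length one, from `0 ≤ ∫ (f - m)²` with `m` the mean.
  have hCS : ∀ t ∈ Set.Icc (0 : ℝ) 1, (∫ s in ((n : ℝ) + t)..(n + t + 1), f s) ^ 2 ≤ r := by
    intro t ht
    set m := ∫ s in ((n : ℝ) + t)..(n + t + 1), f s with hm
    have h1 : 0 ≤ ∫ s in ((n : ℝ) + t)..(n + t + 1), (f s ^ 2 - 2 * m * f s + m ^ 2) :=
      intervalIntegral.integral_nonneg (by linarith) fun s _ => by
        nlinarith [sq_nonneg (f s - m)]
    rw [intervalIntegral.integral_add ((by fun_prop : Continuous _).intervalIntegrable _ _)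
      ((by fun_prop : Continuous _).intervalIntegrable _ _),
      intervalIntegral.integral_sub (hint _ _)
      ((by fun_prop : Continuous _).intervalIntegrable _ _),
      intervalIntegral.integral_const_mul, ← hm, intervalIntegral.integral_const, ← hsub] at h1
    have h2 : F (n + t + 1) ≤ F (n + 2) := hmono (by linarith [ht.2])
    have h3 : F n ≤ F (n + t) := hmono (by linarith [ht.1])
    have h4 : ((n : ℝ) + t + 1 - (n + t)) • m ^ 2 = m ^ 2 := by
      rw [smul_eq_mul]; ring
    rw [h4] at h1
    change m ^ 2 ≤ F (n + 2) - F n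
    nlinarith
  have i1 : ∫ t in (0 : ℝ)..1, f (n + t + 1) ^ 2 ≤ r := by
    have := intervalIntegral.integral_comp_add_left (a := 0) (b := 1)
      (fun s => f s ^ 2) ((n : ℝ) + 1)
    simp only [add_right_comm _ (1 : ℝ), add_zero] at this
    rw [this, ← hsub]
    have h2 : F (n + 1 + 1) = F (n + 2) := by congr 1; ring
    have h3 : F n ≤ F (n + 1) := hmono (by linarith)
    change _ ≤ F (n + 2) - F n
    linarith
  have i2 : ∫ t in (0 : ℝ)..1, f (n + t) ^ 2 ≤ r := by
    have := intervalIntegral.integral_comp_add_left (a := 0) (b := 1)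
      (fun s => f s ^ 2) (n : ℝ)
    simp only [add_zero] at this
    rw [this, ← hsub]
    have h3 : F (n + 1) ≤ F (n + 2) := hmono (by linarith)
    change _ ≤ F (n + 2) - F n
    linarith
  calc ∫ t in (0 : ℝ)..1,
        (f (n + t + 1) - f (n + t) - θ * ∫ s in (n + t)..(n + t + 1), f s) ^ 2
      ≤ ∫ t in (0 : ℝ)..1, (3 * f (n + t + 1) ^ 2 + 3 * f (n + t) ^ 2 + 3 * θ ^ 2 * r) := by
        refine intervalIntegral.integral_mono_on zero_le_one
          ((by fun_prop : Continuous _).intervalIntegrable _ _)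
          ((by fun_prop : Continuous _).intervalIntegrable _ _) fun t ht => ?_
        have := mul_le_mul_of_nonneg_left (hCS t ht) (sq_nonneg θ)
        set m := ∫ s in ((n : ℝ) + t)..(n + t + 1), f s
        nlinarith [sq_nonneg (f (n + t + 1) + f (n + t)), sq_nonneg (f (n + t + 1) + θ * m),
          sq_nonneg (f (n + t) - θ * m)]
    _ = 3 * (∫ t in (0 : ℝ)..1, f (n + t + 1) ^ 2) + 3 * (∫ t in (0 : ℝ)..1, f (n + t) ^ 2)
          + 3 * θ ^ 2 * r := by
        rw [intervalIntegral.integral_add ((by fun_prop : Continuous _).intervalIntegrable _ _)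
          ((by fun_prop : Continuous _).intervalIntegrable _ _),
          intervalIntegral.integral_add ((by fun_prop : Continuous _).intervalIntegrable _ _)
          ((by fun_prop : Continuous _).intervalIntegrable _ _),
          intervalIntegral.integral_const_mul, intervalIntegral.integral_const_mul]
        simp
    _ ≤ 3 * (2 + θ ^ 2) * r := by nlinarith

/-- Convergence to `0` in `L²(0, 1]` forces convergence in measure; the latter is phrased as a
lower bound on a `liminf`, the form in which Fatou's lemma uses it. -/
lemma one_le_liminf_volume_abs_le {g : ℕ → ℝ → ℝ} (hg : ∀ n, Continuous (g n))
    (h : Tendsto (fun n => ∫ t in (0 : ℝ)..1, g n t ^ 2) atTop (nhds 0)) {ε : ℝ} (hε : 0 < ε) :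
    1 ≤ liminf (fun n => volume.restrict (Set.Ioc (0 : ℝ) 1) {t | |g n t| ≤ ε}) atTop := by
  set μ := volume.restrict (Set.Ioc (0 : ℝ) 1) with hμ
  have hbound : ∀ n, μ {t | |g n t| ≤ ε}ᶜ ≤
      ENNReal.ofReal (∫ t in (0 : ℝ)..1, g n t ^ 2) / ENNReal.ofReal (ε ^ 2) := by
    intro n
    have hint : Integrable (fun t => g n t ^ 2) μ :=
      (((hg n).pow 2).intervalIntegrable 0 1).1
    rw [intervalIntegral.integral_of_le zero_le_one,
      ofReal_integral_eq_lintegral_ofReal hint (ae_of_all _ fun _ => sq_nonneg _)]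
    refine le_trans (measure_mono fun t ht => ?_) (meas_ge_le_lintegral_div
      (by have := hg n; fun_prop) (by simpa using hε.ne') ENNReal.ofReal_ne_top)
    have ht : ε < |g n t| := not_le.mp ht
    refine ENNReal.ofReal_le_ofReal ?_
    rw [← sq_abs (g n t)]
    gcongr
  have hlim : Tendsto (fun n => 1 - ENNReal.ofReal (∫ t in (0 : ℝ)..1, g n t ^ 2) /
      ENNReal.ofReal (ε ^ 2)) atTop (nhds 1) := by
    have h1 := ENNReal.Tendsto.div_const (ENNReal.tendsto_ofReal h)
      (b := ENNReal.ofReal (ε ^ 2)) (Or.inr (by simpa using hε.ne'))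
    simpa using ENNReal.Tendsto.sub tendsto_const_nhds h1 (Or.inl ENNReal.one_ne_top)
  rw [← hlim.liminf_eq]
  refine liminf_le_liminf (Eventually.of_forall fun n => ?_)
  have h1 : (1 : ENNReal) = μ Set.univ := by simp [hμ]
  rw [tsub_le_iff_right, h1, ← Set.union_compl_self {t | |g n t| ≤ ε}]
  exact (measure_union_le _ _).trans (add_le_add le_rfl (hbound n))

/-! ### Increments of fractional Brownian motion and joint measurability -/

/-- Increments of unit length of a fractional Brownian motion are standard normal, whatever the
Hurst index. -/
lemma IsFractionalBrownianMotion.map_increment {Ω : Type*} [MeasurableSpace Ω] {P : Measure Ω}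
    [IsProbabilityMeasure P] {H : ℝ} {B : ℝ≥0 → Ω → ℝ} (hH : 0 < H)
    (hB : IsFractionalBrownianMotion H B P) (t : ℝ≥0) :
    P.map (fun ω => B (t + 1) ω - B t ω) = gaussianReal 0 1 := by
  have hG := hB.isGaussianProcess
  have hL2 : ∀ s, MemLp (B s) 2 P := fun s => (hG.hasGaussianLaw_eval s).memLp_two
  have hH' : 2 * H ≠ 0 := by positivity
  rw [(hG.hasGaussianLaw_fun_sub (s := t + 1) (t := t)).map_eq_gaussianReal]
  have h1 : ∫ ω, (B (t + 1) ω - B t ω) ∂P = 0 := by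
    rw [integral_sub ((hL2 _).integrable one_le_two) ((hL2 _).integrable one_le_two),
      hB.integral_eq_zero, hB.integral_eq_zero, sub_zero]
  have h2 : variance (fun ω => B (t + 1) ω - B t ω) P = 1 := by
    rw [variance_fun_sub (hL2 _) (hL2 _), ← covariance_self (hL2 _).aemeasurable,
      ← covariance_self (hL2 _).aemeasurable,
      hB.covariance_eq, hB.covariance_eq, hB.covariance_eq]
    have h3 : ((t : ℝ) - ((t + 1 : ℝ≥0) : ℝ)) = -1 := by push_cast; ring
    rw [h3, sub_self, sub_self, abs_zero, Real.zero_rpow hH', abs_neg, abs_one, Real.one_rpow]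
    ring
  rw [h1, h2, Real.toNNReal_one]

/-- A process with almost surely continuous paths agrees, almost surely along the entire path, with
a jointly measurable process all of whose paths are continuous. -/
lemma exists_measurable_continuous_version {Ω : Type*} [MeasurableSpace Ω] {P : Measure Ω}
    {B : ℝ≥0 → Ω → ℝ} (hm : ∀ t, AEMeasurable (B t) P)
    (hc : ∀ᵐ ω ∂P, Continuous fun t => B t ω) :
    ∃ C : ℝ≥0 → Ω → ℝ, Measurable (Function.uncurry C) ∧ (∀ ω, Continuous fun t => C t ω) ∧
      ∀ᵐ ω ∂P, ∀ t, C t ω = B t ω := by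
  classical
  let u := TopologicalSpace.denseSeq ℝ≥0
  have hall : ∀ᵐ ω ∂P, (Continuous fun t => B t ω) ∧ ∀ n, B (u n) ω = (hm (u n)).mk _ ω :=
    hc.and (ae_all_iff.2 fun n => (hm (u n)).ae_eq_mk)
  obtain ⟨G, hG, hGm, hGsub⟩ := hall.exists_measurable_mem
  let C : ℝ≥0 → Ω → ℝ := fun t => G.indicator (B t)
  have hCc : ∀ ω, Continuous fun t => C t ω := fun ω => by
    by_cases hω : ω ∈ G
    · simpa [C, hω] using (hGsub ω hω).1
    · simpa [C, hω] using continuous_const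
  have hCu : ∀ n, Measurable (C (u n)) := fun n => by
    have : C (u n) = G.indicator ((hm (u n)).mk _) :=
      Set.indicator_congr fun ω hω => (hGsub ω hω).2 n
    rw [this]
    exact (hm (u n)).measurable_mk.indicator hGm
  have hCm : ∀ t, Measurable (C t) := fun t => by
    have ht : t ∈ closure (Set.range u) := TopologicalSpace.denseRange_denseSeq ℝ≥0 t
    obtain ⟨x, hx, hxt⟩ := mem_closure_iff_seq_limit.1 ht
    refine measurable_of_tendsto_metrizable (f := fun n => C (x n)) (fun n => ?_)
      (tendsto_pi_nhds.2 fun ω => ((hCc ω).tendsto t).comp hxt)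
    obtain ⟨k, hk⟩ := hx n
    exact hk ▸ hCu k
  refine ⟨C, measurable_uncurry_of_continuous_of_measurable hCc hCm, hCc, ?_⟩
  filter_upwards [hG] with ω hω t
  simp [C, hω]

/-! ### Identically distributed random functions and convergence in measure -/

/-- If random functions `g n` on `(0, 1]` have a common one-point marginal law `ν`, then the event
that `|g n| ≤ ε` asymptotically on a set of full measure has probability at most `ν [-ε, ε]`. -/
lemma measure_one_le_liminf_volume_le {Ω : Type*} [MeasurableSpace Ω] {P : Measure Ω}
    [SFinite P] {g : ℕ → ℝ → Ω → ℝ} (hg : ∀ n, Measurable (Function.uncurry (g n)))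
    {ν : Measure ℝ} (hν : ∀ n, ∀ t ∈ Set.Ioc (0 : ℝ) 1, P.map (g n t) = ν) (ε : ℝ) :
    P {ω | 1 ≤ liminf (fun n => volume.restrict (Set.Ioc (0 : ℝ) 1) {t | |g n t ω| ≤ ε}) atTop}
      ≤ ν (Set.Icc (-ε) ε) := by
  set μ := volume.restrict (Set.Ioc (0 : ℝ) 1) with hμ
  have hS : ∀ n, MeasurableSet {p : ℝ × Ω | |g n p.1 p.2| ≤ ε} := fun n =>
    measurableSet_le (hg n).abs measurable_const
  have hmeas : ∀ n, Measurable fun ω => μ {t | |g n t ω| ≤ ε} := fun n =>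
    measurable_measure_prodMk_right (hS n)
  have hval : ∀ n, ∫⁻ ω, μ {t | |g n t ω| ≤ ε} ∂P = ν (Set.Icc (-ε) ε) := fun n => by
    have h1 : μ.prod P {p : ℝ × Ω | |g n p.1 p.2| ≤ ε} = ∫⁻ ω, μ {t | |g n t ω| ≤ ε} ∂P :=
      Measure.prod_apply_symm (hS n)
    rw [← h1, Measure.prod_apply (hS n)]
    have h2 : ∀ᵐ t ∂μ, P (Prod.mk t ⁻¹' {p : ℝ × Ω | |g n p.1 p.2| ≤ ε}) =
        ν (Set.Icc (-ε) ε) := by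
      filter_upwards [ae_restrict_mem measurableSet_Ioc] with t ht
      rw [← hν n t ht, Measure.map_apply (hg n).of_uncurry_left measurableSet_Icc]
      congr 1
      ext ω
      simp [abs_le]
    rw [lintegral_congr_ae h2]
    simp [hμ]
  calc P {ω | 1 ≤ liminf (fun n => μ {t | |g n t ω| ≤ ε}) atTop}
      ≤ ∫⁻ ω, liminf (fun n => μ {t | |g n t ω| ≤ ε}) atTop ∂P := by
        simpa using mul_meas_ge_le_lintegral (μ := P) (Measurable.liminf hmeas) 1
    _ ≤ liminf (fun n => ∫⁻ ω, μ {t | |g n t ω| ≤ ε} ∂P) atTop := lintegral_liminf_le hmeas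
    _ = ν (Set.Icc (-ε) ε) := by simp [hval]

/-- If the common marginal law moreover has no atom at `0`, then almost surely `g n` does not tend
to `0` in measure. -/
lemma ae_exists_not_one_le_liminf_volume {Ω : Type*} [MeasurableSpace Ω] {P : Measure Ω}
    [SFinite P] {g : ℕ → ℝ → Ω → ℝ} (hg : ∀ n, Measurable (Function.uncurry (g n)))
    {ν : Measure ℝ} [IsFiniteMeasure ν] (hν0 : ν {0} = 0)
    (hν : ∀ n, ∀ t ∈ Set.Ioc (0 : ℝ) 1, P.map (g n t) = ν) :
    ∀ᵐ ω ∂P, ∃ ε > 0, ¬ 1 ≤ liminf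
      (fun n => volume.restrict (Set.Ioc (0 : ℝ) 1) {t | |g n t ω| ≤ ε}) atTop := by
  set e : ℕ → ℝ := fun k => 1 / ((k : ℝ) + 1)
  have he : Tendsto e atTop (nhds 0) := tendsto_one_div_add_atTop_nhds_zero_nat
  have hanti : Antitone fun k => Set.Icc (-e k) (e k) := fun i j hij =>
    Set.Icc_subset_Icc (neg_le_neg (Nat.one_div_le_one_div hij)) (Nat.one_div_le_one_div hij)
  have hinter : ⋂ k, Set.Icc (-e k) (e k) = {0} := by
    ext x
    simp only [Set.mem_iInter, ← abs_le, Set.mem_Icc, Set.mem_singleton_iff]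
    refine ⟨fun hx => abs_nonpos_iff.1 (ge_of_tendsto' he hx), fun hx k => ?_⟩
    rw [hx, abs_zero]
    positivity
  have hlim : Tendsto (fun k => ν (Set.Icc (-e k) (e k))) atTop (nhds 0) := by
    rw [← hν0, ← hinter]
    exact tendsto_measure_iInter_atTop (fun _ => measurableSet_Icc.nullMeasurableSet) hanti
      ⟨0, measure_ne_top _ _⟩
  rw [ae_iff]
  refine le_antisymm (ge_of_tendsto' hlim fun k => ?_) zero_le
  refine (measure_mono fun ω hω => ?_).trans (measure_one_le_liminf_volume_le hg hν (e k))
  simp only [Set.mem_ofPred_eq, not_exists, not_and, not_not] at hω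
  exact hω (e k) Nat.one_div_pos_of_nat

/-! ### Divergence of the energy -/

theorem lemma6p2 {Ω : Type*} [MeasurableSpace Ω] (P : Measure Ω) [IsProbabilityMeasure P]
    (H : ℝ) (hH : H ∈ Set.Ioo (0 : ℝ) (1 / 2)) (x₀ θ : ℝ) (B X : ℝ≥0 → Ω → ℝ)
    (hB : IsFractionalBrownianMotion H B P) (hX : IsLangevinSolution x₀ θ B X P) :
    ∀ᵐ ω ∂P, Tendsto (fun T : ℝ => ∫ s in (0 : ℝ)..T, (X s.toNNReal ω) ^ 2) atTop atTop := by
  obtain ⟨C, hCm, hCc, hCB⟩ := exists_measurable_continuous_version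
    hB.isGaussianProcess.aemeasurable hB.continuous_paths
  let τ : ℕ → ℝ → ℝ≥0 := fun n t => (n + t).toNNReal
  have hτ : ∀ n, Continuous (τ n) := fun n => by fun_prop
  let g : ℕ → ℝ → Ω → ℝ := fun n t ω => C (τ n t + 1) ω - C (τ n t) ω
  have hg : ∀ n, Measurable (Function.uncurry (g n)) := fun n => by
    have hτm : Measurable (τ n) := (hτ n).measurable
    have h1 : Measurable fun p : ℝ × Ω => (τ n p.1 + 1, p.2) := by fun_prop
    have h2 : Measurable fun p : ℝ × Ω => (τ n p.1, p.2) := by fun_prop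
    exact (hCm.comp h1).sub (hCm.comp h2)
  have hlaw : ∀ n, ∀ t ∈ Set.Ioc (0 : ℝ) 1, P.map (g n t) = gaussianReal 0 1 := fun n t _ => by
    rw [← hB.map_increment hH.1 (τ n t)]
    refine Measure.map_congr ?_
    filter_upwards [hCB] with ω hω
    simp [g, hω]
  have hν0 : gaussianReal 0 1 {0} = 0 := by
    have := nullSingletonClass_gaussianReal (μ := 0) (v := 1) one_ne_zero
    exact measure_singleton 0
  filter_upwards [ae_exists_not_one_le_liminf_volume hg hν0 hlaw, hCB, hX.integrable_paths,
    hX.equation] with ω hω hCω hint heq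
  by_contra hT
  obtain ⟨ε, hε, hn⟩ := hω
  refine hn (one_le_liminf_volume_abs_le (g := fun n t => g n t ω) (fun n => ?_) ?_ hε)
  · have := hτ n
    exact ((hCc ω).comp (by fun_prop)).sub ((hCc ω).comp this)
  have hxc : Continuous fun t => X t ω := continuous_of_langevin_equation
    (by simpa [hCω] using hCc ω) hint heq
  have hfc : Continuous fun s : ℝ => X s.toNNReal ω := hxc.comp continuous_real_toNNReal
  refine (tendsto_integral_sq_increment hfc θ hT).congr fun n => ?_
  refine intervalIntegral.integral_congr fun t ht => ?_
  rw [Set.uIcc_of_le zero_le_one] at ht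
  have h0 : (0 : ℝ) ≤ n + t := add_nonneg n.cast_nonneg ht.1
  have h1 : ((n : ℝ) + t + 1).toNNReal = τ n t + 1 := by
    rw [Real.toNNReal_add h0 zero_le_one, Real.toNNReal_one]
  have h2 : ((τ n t : ℝ≥0) : ℝ) = n + t := Real.coe_toNNReal _ h0
  have e1 := heq (τ n t + 1)
  have e2 := heq (τ n t)
  rw [NNReal.coe_add, NNReal.coe_one, h2] at e1
  rw [h2] at e2
  have e3 := intervalIntegral.integral_interval_sub_left
    (hfc.intervalIntegrable (μ := volume) 0 ((n : ℝ) + t + 1))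
    (hfc.intervalIntegrable (μ := volume) 0 ((n : ℝ) + t))
  simp only [g, h1, hCω]
  change (X (τ n t + 1) ω - X (τ n t) ω - _) ^ 2 = _
  rw [← e3]
  congr 1
  linarith
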